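/- Let $\mathrm{ex}(n,C_4)$ denote the maximum number of edges in a simple graph on $n$ vertices that does not contain a cycle of length four as a (not necessarily induced) subgraph. Let $q$ be a prime power and let $r$ be a sufficiently large integer with $r=o(q)$. Then $$\mathrm{ex}(q^2+q+1-r,\,C_4)=\tfrac12 q(q+1)^2-(1-o(1))\,rq ,$$ where the $o(1)$ term is nonnegative and tends to $0$ as $r\to\infty$ and $r/q\to 0$. Precisely: for every real $\varepsilon>0$ there exist a real $\delta>0$ and an integer $R$ such that for every prime power $q$ and every integer $r$ with $R\le r\le \delta q$ and $q^2+q+1-r\ge 0$, $$\tfrac12 q(q+1)^2-rq\;\le\;\mathrm{ex}(q^2+q+1-r,\,C_4)\;\le\;\tfrac12 q(q+1)^2-(1-\varepsilon)\,rq .$$ -/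

import Mathlib

open Finset

/-! Upper bound. Let x(v) = q + 1 - deg(v), D = ∑ x and n = q² + q + 1 - r. Since 2e = (q + 1)n - D,
it suffices that D ≥ (1 - o(1))rq. Counting 2-walks from v in a C₄-free graph shows that x sums to
at least r - q·x(v) over the neighbours of v (`le_sum_mul_rowDeficit`). Rows with x(v) ≤ 0 thus
contribute at least r each, about rq² in total, whereas all rows together contribute (q + 1)D - ∑ x²
≤ (q + 1)D.

The danger is a very negative contribution from the set T of rows with x > 0. A mixing inequality
(`sq_sum_count_mul_sub_le`) excludes it: neighbourhoods of T are spread evenly, so the contribution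
is close to its mean. For the error to be o(rq²), large positive deficits are truncated to 0, and
the negative part of x is controlled in sum (`sum_neg_rowDeficit_le`) and pointwise
(`neg_rowDeficit_lt`).

Lower bound. The polarity graph of the plane over the field of order q has q(q + 1)²/2 edges and q +
1 absolute points of degree q; deleting r of these costs at most rq edges. -/

/-- `a` is a symmetric `0`-`1` matrix on `q² + q + 1 - r` points, any two distinct rows of which
have at most one common `1`, with row sums that differ from `q + 1` by integers. -/
structure IsPartialPolarity {V : Type*} [Fintype V] (a : V → V → ℝ) (q r : ℝ) : Prop where
  symm : ∀ u v, a u v = a v u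
  idem : ∀ u v, a u v * a u v = a u v
  codeg : ∀ u v, u ≠ v → ∑ w, a u w * a v w ≤ 1
  card : (Fintype.card V : ℝ) = q ^ 2 + q + 1 - r
  integral : ∀ v, ∃ k : ℤ, q + 1 - ∑ w, a v w = k

/-- The amount by which the row sum at `v` falls short of `q + 1`. -/
def rowDeficit {V : Type*} [Fintype V] (a : V → V → ℝ) (q : ℝ) (v : V) : ℝ :=
  q + 1 - ∑ w, a v w

/-! ### Degree deficits: walk counting, mixing, and the lower bound on their sum. -/

namespace IsPartialPolarity

variable {V : Type*} [Fintype V] {a : V → V → ℝ} {q r : ℝ}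

theorem nonneg (h : IsPartialPolarity a q r) (u v : V) : 0 ≤ a u v := by
  rw [← h.idem]; exact mul_self_nonneg _

theorem sum_row (v : V) : ∑ w, a v w = q + 1 - rowDeficit a q v := by
  simp [rowDeficit]

/-- Among the 2-walks from `v`, at most one ends at each other vertex, and deg(v) of them return to
`v`. -/
theorem le_sum_mul_rowDeficit (h : IsPartialPolarity a q r) (v : V) :
    r - q * rowDeficit a q v ≤ ∑ u, a v u * rowDeficit a q u := by
  classical
  have h1 : ∑ u, a v u * ∑ w, a u w ≤ ∑ w, a v w + ((Fintype.card V : ℝ) - 1) := by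
    calc ∑ u, a v u * ∑ w, a u w = ∑ w, ∑ u, a v u * a w u := by
          simp_rw [mul_sum]
          rw [sum_comm]
          exact sum_congr rfl fun w _ => sum_congr rfl fun u _ => by rw [h.symm u w]
      _ ≤ ∑ w, (1 + if w = v then (∑ w, a v w) - 1 else 0) := by
          refine sum_le_sum fun w _ => ?_
          split_ifs with hw
          · subst hw
            simp [h.idem]
          · simpa using h.codeg v w (Ne.symm hw)
      _ = _ := by
          rw [sum_add_distrib]
          simp
          ring
  have h2 : ∑ u, a v u * rowDeficit a q u
      = (q + 1) * ∑ u, a v u - ∑ u, a v u * ∑ w, a u w := by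
    rw [mul_sum, ← sum_sub_distrib]
    exact sum_congr rfl fun u _ => by rw [rowDeficit]; ring
  rw [h2, sum_row (a := a) (q := q) v]
  rw [sum_row (a := a) (q := q) v, h.card] at h1
  linarith

theorem sum_sum_mul_rowDeficit (h : IsPartialPolarity a q r) :
    ∑ v, ∑ u, a v u * rowDeficit a q u
      = (q + 1) * ∑ v, rowDeficit a q v - ∑ v, rowDeficit a q v ^ 2 := by
  rw [sum_comm, mul_sum, ← sum_sub_distrib]
  refine sum_congr rfl fun u _ => ?_
  rw [← sum_mul, sum_congr rfl fun v _ => h.symm v u, sum_row (a := a) (q := q) u]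
  ring

theorem sum_sq_rowDeficit_le (h : IsPartialPolarity a q r) :
    ∑ v, rowDeficit a q v ^ 2
      ≤ (2 * q + 1) * ∑ v, rowDeficit a q v - (q ^ 2 + q + 1 - r) * r := by
  have h1 : ∑ v, (r - q * rowDeficit a q v) ≤ ∑ v, ∑ u, a v u * rowDeficit a q u :=
    sum_le_sum fun v _ => h.le_sum_mul_rowDeficit v
  rw [h.sum_sum_mul_rowDeficit, sum_sub_distrib, ← mul_sum] at h1
  simp only [sum_const, card_univ, nsmul_eq_mul, h.card] at h1
  linarith

theorem sum_sq_count_le (h : IsPartialPolarity a q r) (S : Finset V) :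
    ∑ v, (∑ u ∈ S, a u v) ^ 2 ≤ ∑ u ∈ S, ∑ w, a u w + (#S : ℝ) ^ 2 := by
  classical
  calc ∑ v, (∑ u ∈ S, a u v) ^ 2 = ∑ u ∈ S, ∑ w ∈ S, ∑ v, a u v * a w v := by
        simp_rw [sq, sum_mul_sum]
        rw [sum_comm]
        exact sum_congr rfl fun u _ => sum_comm
    _ ≤ ∑ u ∈ S, ∑ w ∈ S, (1 + if u = w then ∑ v, a u v else 0) := by
        refine sum_le_sum fun u _ => sum_le_sum fun w _ => ?_
        split_ifs with hw
        · subst hw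
          simp [h.idem]
        · simpa using h.codeg u w hw
    _ = _ := by
        simp only [sum_add_distrib, sum_const, nsmul_eq_mul, mul_one, sum_ite_eq]
        rw [sum_congr rfl fun u hu => if_pos hu]
        ring

/-- Expander mixing without eigenvalues: the codegree condition bounds the second moment of the
number of neighbours in `S`, hence its variance, and Cauchy–Schwarz pairs the deviation from the
mean with `y`. -/
theorem sq_sum_count_mul_sub_le (h : IsPartialPolarity a q r) (hV : 0 < q ^ 2 + q + 1 - r)
    (S : Finset V) (y : V → ℝ) :
    (∑ u ∈ S, ∑ v, a u v * y v
        - (∑ u ∈ S, ∑ w, a u w) / (q ^ 2 + q + 1 - r) * ∑ v, y v) ^ 2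
      ≤ (∑ u ∈ S, ∑ w, a u w + (#S : ℝ) ^ 2
          - (∑ u ∈ S, ∑ w, a u w) ^ 2 / (q ^ 2 + q + 1 - r)) * ∑ v, y v ^ 2 := by
  set n := q ^ 2 + q + 1 - r with hn
  set s := ∑ u ∈ S, ∑ w, a u w with hs
  have hcount : ∑ v, ∑ u ∈ S, a u v = s := sum_comm
  have h1 : ∑ u ∈ S, ∑ v, a u v * y v - s / n * ∑ v, y v
      = ∑ v, ((∑ u ∈ S, a u v) - s / n) * y v := by
    rw [sum_comm, mul_sum, ← sum_sub_distrib]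
    exact sum_congr rfl fun v _ => by rw [sub_mul, sum_mul]
  have h2 : ∑ v, ((∑ u ∈ S, a u v) - s / n) ^ 2 ≤ s + (#S : ℝ) ^ 2 - s ^ 2 / n := by
    have : ∑ v, ((∑ u ∈ S, a u v) - s / n) ^ 2
        = ∑ v, (∑ u ∈ S, a u v) ^ 2 - 2 * (s / n) * s + n * (s / n) ^ 2 := by
      simp_rw [sub_sq, sum_add_distrib, sum_sub_distrib]
      rw [← sum_mul, ← mul_sum, hcount]
      simp only [sum_const, card_univ, nsmul_eq_mul, h.card]
      ring
    rw [this]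
    have h3 : n * (s / n) ^ 2 = s ^ 2 / n := by field_simp
    have h4 : 2 * (s / n) * s = 2 * (s ^ 2 / n) := by ring
    have := h.sum_sq_count_le S
    rw [h3, h4]
    linarith
  rw [h1]
  exact (sum_mul_sq_le_sq_mul_sq _ _ _).trans
    (mul_le_mul_of_nonneg_right h2 (sum_nonneg fun v _ => sq_nonneg _))

theorem sum_sq_rowDeficit_le_of_sum_le (h : IsPartialPolarity a q r) (hq : 1 ≤ q) (hr : 0 ≤ r)
    (hrq : 8 * r ≤ q) (hD : ∑ v, rowDeficit a q v ≤ r * q) :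
    ∑ v, rowDeficit a q v ^ 2 ≤ 2 * r * q ^ 2 := by
  have h1 := h.sum_sq_rowDeficit_le
  have h2 : (2 * q + 1) * ∑ v, rowDeficit a q v ≤ (2 * q + 1) * (r * q) := by gcongr
  have h3 : r * r ≤ r * q := by gcongr; linarith
  have h4 : r * q ≤ r * q ^ 2 := by gcongr; nlinarith
  nlinarith

-- Neighbours of the set `P` of vertices with negative deficit carry total deficit at least qZ,
-- while the mean predicts at most qZ/2. Mixing then gives (qZ/2)² ≤ (q + 2)Z · 2rq².
open Classical in
theorem sum_neg_rowDeficit_le (h : IsPartialPolarity a q r) (hq : 1 ≤ q) (hr : 0 ≤ r)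
    (hrq : 8 * r ≤ q) (hD : ∑ v, rowDeficit a q v ≤ r * q) :
    ∑ v with rowDeficit a q v < 0, -rowDeficit a q v ≤ 24 * r * q := by
  set x := rowDeficit a q with hx
  set P : Finset V := {v | x v < 0} with hP
  set Z := ∑ v ∈ P, -x v with hZ
  have hX := h.sum_sq_rowDeficit_le_of_sum_le hq hr hrq hD
  have hn : 0 < q ^ 2 + q + 1 - r := by nlinarith
  have hs : ∑ u ∈ P, ∑ w, a u w = (q + 1) * #P + Z := by
    rw [sum_congr rfl fun u _ => sum_row (a := a) (q := q) u, sum_sub_distrib, hZ, sum_neg_distrib]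
    simp only [sum_const, nsmul_eq_mul]
    ring
  -- By integrality each negative deficit is at most -1.
  have hpZ : (#P : ℝ) ≤ Z := by
    rw [hZ, card_eq_sum_ones, Nat.cast_sum]
    refine sum_le_sum fun v hv => ?_
    obtain ⟨k, hk⟩ := h.integral v
    have hv' : x v < 0 := by simpa [hP] using hv
    have hxk : x v = k := hk
    rw [hxk] at hv' ⊢
    have : k ≤ -1 := by
      have : k < 0 := by exact_mod_cast hv'
      omega
    have : (k : ℝ) ≤ -1 := by exact_mod_cast this
    push_cast
    linarith
  have hp0 : (0 : ℝ) ≤ #P := by positivity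
  have hZ0 : 0 ≤ Z := hp0.trans hpZ
  have ht : q * Z ≤ ∑ u ∈ P, ∑ v, a u v * x v := by
    rw [hZ, mul_sum]
    refine sum_le_sum fun v _ => le_trans ?_ (h.le_sum_mul_rowDeficit v)
    simp only [hx]
    linarith
  have hmix := h.sq_sum_count_mul_sub_le hn P x
  rw [hs] at hmix
  set n := q ^ 2 + q + 1 - r with hn'
  set t := ∑ u ∈ P, ∑ v, a u v * x v
  set D := ∑ v, x v
  have hs2 : ((q + 1) * #P + Z) ≤ (q + 2) * Z := by nlinarith
  have hs0 : 0 ≤ (q + 1) * #P + Z := by positivity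
  have hmean : ((q + 1) * #P + Z) / n * D ≤ q * Z / 2 := by
    calc ((q + 1) * #P + Z) / n * D ≤ ((q + 1) * #P + Z) / n * (r * q) := by gcongr
      _ ≤ ((q + 2) * Z) / n * (r * q) := by gcongr
      _ = (q + 2) * r / n * (q * Z) := by ring
      _ ≤ 1 / 2 * (q * Z) := by
        have : (q + 2) * r / n ≤ 1 / 2 := by
          rw [div_le_iff₀ hn]
          nlinarith
        exact mul_le_mul_of_nonneg_right this (by positivity)
      _ = _ := by ring
  have hvar : (q + 1) * #P + Z + (#P : ℝ) ^ 2 - ((q + 1) * #P + Z) ^ 2 / n ≤ (q + 2) * Z := by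
    have : (#P : ℝ) ^ 2 ≤ ((q + 1) * #P + Z) ^ 2 / n := by
      rw [le_div_iff₀ hn]
      calc (#P : ℝ) ^ 2 * n ≤ (#P : ℝ) ^ 2 * (q + 1) ^ 2 := by gcongr; nlinarith
        _ = ((q + 1) * #P) ^ 2 := by ring
        _ ≤ _ := by gcongr; linarith
    linarith
  have hfin : (q * Z / 2) ^ 2 ≤ (q + 2) * Z * (2 * r * q ^ 2) := by
    calc (q * Z / 2) ^ 2 ≤ (t - ((q + 1) * #P + Z) / n * D) ^ 2 := by
          gcongr
          linarith
      _ ≤ _ := hmix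
      _ ≤ (q + 2) * Z * ∑ v, x v ^ 2 := by gcongr
      _ ≤ _ := by gcongr
  rcases hZ0.eq_or_lt with h0 | h0
  · rw [← h0]; positivity
  · have h5 : (q ^ 2 * Z) * Z ≤ (q ^ 2 * Z) * (8 * r * (q + 2)) := by nlinarith
    have h6 := le_of_mul_le_mul_left h5 (by positivity)
    nlinarith

/-- If x(v) = -z, the neighbours of `v` carry deficit at least qz, so Cauchy–Schwarz on the row of
`v` gives z² ≤ 2r(q + 1 + z), which fails once z ≥ ηq. -/
theorem neg_rowDeficit_lt (h : IsPartialPolarity a q r) (hq : 1 ≤ q) (hr : 0 ≤ r)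
    (hrq : 8 * r ≤ q) (hD : ∑ v, rowDeficit a q v ≤ r * q) {η : ℝ} (hη : 0 < η) (hη1 : η ≤ 1)
    (hrη : 6 * r < η ^ 2 * q) (v : V) : -rowDeficit a q v < η * q := by
  by_contra! hc
  have hX := h.sum_sq_rowDeficit_le_of_sum_le hq hr hrq hD
  have h1 := h.le_sum_mul_rowDeficit v
  have h2 := sum_mul_sq_le_sq_mul_sq univ (a v) (rowDeficit a q)
  have h3 : ∑ u, a v u ^ 2 = q + 1 - rowDeficit a q v := by
    rw [← sum_row]
    exact sum_congr rfl fun u _ => by rw [sq, h.idem]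
  rw [h3] at h2
  set z := -rowDeficit a q v with hz
  have hxz : rowDeficit a q v = -z := by rw [hz]; ring
  rw [hxz] at h1 h2
  have hz0 : 0 < z := lt_of_lt_of_le (by positivity) hc
  have h4 : (q * z) ^ 2 ≤ (q + 1 - -z) * (2 * r * q ^ 2) := by
    calc (q * z) ^ 2 ≤ (∑ u, a v u * rowDeficit a q u) ^ 2 := by gcongr; linarith
      _ ≤ _ := h2
      _ ≤ _ := by gcongr; linarith
  have h5 : z ^ 2 ≤ 2 * r * (q + 1 + z) := by
    have : q ^ 2 * z ^ 2 ≤ q ^ 2 * (2 * r * (q + 1 + z)) := by linarith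
    exact le_of_mul_le_mul_left this (by positivity)
  have h6 : η * (q + 1 + z) ≤ 3 * z := by nlinarith
  have h7 : z * (η * z) ≤ z * (6 * r) := by
    have : 2 * r * (η * (q + 1 + z)) ≤ 2 * r * (3 * z) := by gcongr
    nlinarith
  have h8 := le_of_mul_le_mul_left h7 hz0
  nlinarith

/-- The term p² alone may be of order r²q², too large. The squared mean cancels it up to 100rp,
since (q + 1)² ≥ n and the cross term is controlled by `X`. -/
theorem count_variance_le {q r n p X : ℝ} (hq : 1 ≤ q) (hr : 0 ≤ r) (hrq : 100 * r ≤ q)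
    (hn : 0 < n) (hn' : n = q ^ 2 + q + 1 - r) (hp : 0 ≤ p) (hpX : p ≤ X)
    (hX : X ≤ 25 * r * q) :
    (q + 1) * p - X + p ^ 2 - ((q + 1) * p - X) ^ 2 / n ≤ 75 * r * q ^ 2 := by
  have h1 : p ^ 2 - 100 * r * p ≤ ((q + 1) * p - X) ^ 2 / n := by
    rw [le_div_iff₀ hn]
    have h2 : p ^ 2 * n ≤ p ^ 2 * (q + 1) ^ 2 := by gcongr; nlinarith
    have h3 : 2 * (q + 1) * p * X ≤ 2 * (q + 1) * p * (25 * r * q) := by gcongr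
    have h4 : 2 * (q + 1) * p * (25 * r * q) ≤ 100 * r * p * n := by
      have : (q + 1) * q ≤ 2 * n := by nlinarith
      have := mul_le_mul_of_nonneg_left this (show 0 ≤ 50 * (r * p) by positivity)
      linarith
    linarith [sq_nonneg X]
  have h5 : (q + 1 + 100 * r) * p ≤ (3 * q) * (25 * r * q) := by
    gcongr
    · linarith
    · linarith
  linarith

set_option maxHeartbeats 1000000 in
open Classical in
theorem sum_rowDeficit_ge (h : IsPartialPolarity a q r) (hq : 1 ≤ q) (hr : 0 ≤ r)
    (hrq : 100 * r ≤ q) {κ : ℝ} (hκ : 0 < κ) (hκ1 : κ ≤ 1) (hrκ : 6 * r < κ ^ 4 * q) :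
    r * q - 1300 * r ^ 2 - 61 * κ * r * q ≤ ∑ v, rowDeficit a q v := by
  -- The negated bound supplies D ≤ rq, which the preceding estimates require.
  by_contra! hlt
  have hrq0 : 0 ≤ r * q := by positivity
  have hD : ∑ v, rowDeficit a q v ≤ r * q := by
    have : 0 ≤ κ * r * q := by positivity
    nlinarith [sq_nonneg r]
  have hrq8 : 8 * r ≤ q := by linarith
  have hZ := h.sum_neg_rowDeficit_le hq hr hrq8 hD
  have hsmall := h.neg_rowDeficit_lt hq hr hrq8 hD (η := κ ^ 2) (by positivity)
    (by nlinarith) (by nlinarith)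
  have hn : 0 < q ^ 2 + q + 1 - r := by nlinarith
  set x := rowDeficit a q with hx
  set Z := ∑ v with x v < 0, -x v with hZdef
  set T : Finset V := {v | 0 < x v} with hT
  set XT := ∑ v ∈ T, x v with hXT
  set D := ∑ v, x v with hDdef
  have hsplit : XT = D + Z := by
    rw [hXT, hDdef, hZdef, hT, sum_filter, sum_filter, ← sum_add_distrib]
    refine sum_congr rfl fun v _ => ?_
    split_ifs <;> linarith
  have hXT25 : XT ≤ 25 * r * q := by linarith
  have hTX : (#T : ℝ) ≤ XT := by
    rw [hXT, card_eq_sum_ones, Nat.cast_sum]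
    refine sum_le_sum fun v hv => ?_
    obtain ⟨k, hk⟩ := h.integral v
    have hv' : 0 < x v := by simpa [hT] using hv
    have hxk : x v = k := hk
    rw [hxk] at hv' ⊢
    exact_mod_cast hv'
  have hT0 : (0 : ℝ) ≤ #T := by positivity
  -- Dropping large positive deficits only lowers the sum over rows of `T`, and it brings ∑ y² from
  -- order rq² down to order κ²rq².
  set y : V → ℝ := fun v => if x v < κ ^ 2 * q then x v else 0 with hy
  have hηq : 0 < κ ^ 2 * q := by positivity
  have hyx : ∀ v, y v ≤ x v := fun v => by
    simp only [hy]; split_ifs <;> linarith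
  -- Surviving entries satisfy |x| ≤ κ²q, the negative ones by `hsmall`, and ∑ |x| = D + 2Z ≤ 49rq.
  have hysq : ∑ v, y v ^ 2 ≤ κ ^ 2 * q * (49 * r * q) := by
    calc ∑ v, y v ^ 2 ≤ ∑ v, κ ^ 2 * q * (x v + 2 * if x v < 0 then -x v else 0) := by
          refine sum_le_sum fun v _ => ?_
          have := hsmall v
          simp only [hy]
          split_ifs <;> nlinarith
      _ = κ ^ 2 * q * (D + 2 * Z) := by
          rw [← mul_sum, sum_add_distrib, ← mul_sum, ← sum_filter]
      _ ≤ _ := by gcongr; linarith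
  have hysum : -Z ≤ ∑ v, y v := by
    rw [hZdef, sum_filter, ← sum_neg_distrib]
    refine sum_le_sum fun v _ => ?_
    simp only [hy]
    split_ifs <;> linarith
  have hZ0 : 0 ≤ Z := sum_nonneg fun v hv => by
    have : x v < 0 := by simpa using hv
    linarith
  have hs : ∑ u ∈ T, ∑ w, a u w = (q + 1) * #T - XT := by
    rw [sum_congr rfl fun u _ => sum_row (a := a) (q := q) u, sum_sub_distrib, hXT]
    simp only [sum_const, nsmul_eq_mul]
    ring
  have hs0 : 0 ≤ (q + 1) * #T - XT := by
    rw [← hs]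
    exact sum_nonneg fun u _ => sum_nonneg fun w _ => h.nonneg u w
  have hmix := h.sq_sum_count_mul_sub_le hn T y
  rw [hs] at hmix
  have htot := h.sum_sum_mul_rowDeficit
  rw [← hx, ← sum_filter_add_sum_filter_not univ (fun v => 0 < x v)] at htot
  have hout : r * (q ^ 2 + q + 1 - r - #T)
      ≤ ∑ v with ¬ 0 < x v, ∑ u, a v u * x u := by
    have hc : (#{v | ¬ 0 < x v} : ℝ) = q ^ 2 + q + 1 - r - #T := by
      rw [← h.card, eq_sub_iff_add_eq', ← Nat.cast_add, hT,
        card_filter_add_card_filter_not, card_univ]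
    rw [← hc, mul_comm, ← nsmul_eq_mul]
    refine card_nsmul_le_sum _ _ _ fun v hv => ?_
    have hv' : x v ≤ 0 := by simpa using hv
    have := h.le_sum_mul_rowDeficit v
    rw [← hx] at this
    nlinarith
  have hin : ∑ u ∈ T, ∑ v, a u v * y v ≤ ∑ v with 0 < x v, ∑ u, a v u * x u :=
    sum_le_sum fun u _ => sum_le_sum fun v _ => mul_le_mul_of_nonneg_left (hyx v) (h.nonneg u v)
  have hXsq : 0 ≤ ∑ v, x v ^ 2 := sum_nonneg fun v _ => sq_nonneg _
  set t := ∑ u ∈ T, ∑ v, a u v * y v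
  set n := q ^ 2 + q + 1 - r with hn'
  set c := ((q + 1) * #T - XT) / n with hc
  have hc0 : 0 ≤ c := by positivity
  have hc50 : c ≤ 50 * r := by
    rw [hc, div_le_iff₀ hn]
    have h1 : (q + 1) * #T ≤ (q + 1) * (25 * r * q) := by gcongr; linarith
    have h2 : (q + 1) * q ≤ 2 * n := by nlinarith
    have h3 : 25 * r * ((q + 1) * q) ≤ 25 * r * (2 * n) :=
      mul_le_mul_of_nonneg_left h2 (by positivity)
    linarith
  have hmean : -(1200 * r ^ 2 * q) ≤ c * ∑ v, y v := by
    calc -(1200 * r ^ 2 * q) = -(50 * r * (24 * r * q)) := by ring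
      _ ≤ -(c * Z) := by gcongr
      _ = c * -Z := by ring
      _ ≤ _ := by gcongr
  have hvar : (q + 1) * #T - XT + (#T : ℝ) ^ 2 - ((q + 1) * #T - XT) ^ 2 / n
      ≤ 75 * r * q ^ 2 :=
    count_variance_le hq hr hrq hn rfl hT0 hTX hXT25
  -- The constant 61 comes from 75 · 49 = 3675 ≤ 61².
  have hdev : (t - c * ∑ v, y v) ^ 2 ≤ (61 * κ * r * q ^ 2) ^ 2 := by
    calc (t - c * ∑ v, y v) ^ 2 ≤ _ := hmix
      _ ≤ 75 * r * q ^ 2 * (κ ^ 2 * q * (49 * r * q)) := by gcongr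
      _ = 3675 * (κ * r * q ^ 2) ^ 2 := by ring
      _ ≤ 3721 * (κ * r * q ^ 2) ^ 2 := by gcongr; norm_num
      _ = _ := by ring
  have hdev' := (abs_le.1 (abs_le_of_sq_le_sq hdev (by positivity))).1
  have hmain : r * (n - #T) - 61 * κ * r * q ^ 2 - 1200 * r ^ 2 * q ≤ (q + 1) * D := by
    linarith
  have h8 : r * #T ≤ r * (25 * r * q) := by gcongr; linarith
  have h9 : (q + 1) * D < (q + 1) * (r * q - 1300 * r ^ 2 - 61 * κ * r * q) := by gcongr
  have h10 : r * n = r * (q ^ 2 + q + 1) - r ^ 2 := by rw [hn']; ring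
  have h11 : r ^ 2 ≤ r ^ 2 * q := le_mul_of_one_le_right (sq_nonneg r) hq
  have h12 : 0 ≤ κ * r * q := by positivity
  linarith [sq_nonneg r]

end IsPartialPolarity

/-! ### From C₄-free graphs to deficits; the upper bound on the extremal number. -/

namespace SimpleGraph

theorem cycleGraph_four_free_iff {V : Type*} {G : SimpleGraph V} :
    (cycleGraph 4).Free G ↔ ∀ u v w w', u ≠ v → G.Adj u w → G.Adj v w → G.Adj u w' →
      G.Adj v w' → w = w' := by
  constructor
  · intro h u v w w' huv h1 h2 h3 h4
    by_contra hw
    refine h ⟨⟨⟨![u, w, v, w'], ?_⟩, ?_⟩⟩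
    · intro i j hij
      fin_cases i <;> fin_cases j <;>
        first
        | (exfalso; revert hij; decide)
        | simp [h1, h2, h3, h4, h1.symm, h2.symm, h3.symm, h4.symm]
    · intro i j hij
      fin_cases i <;> fin_cases j <;>
        simp_all [h1.ne, h1.ne', h2.ne, h2.ne', h3.ne, h3.ne', h4.ne, h4.ne', Ne.symm huv,
          Ne.symm hw]
  · rintro h ⟨f⟩
    have hadj : ∀ i j : Fin 4, (cycleGraph 4).Adj i j → G.Adj (f i) (f j) :=
      fun i j hij => f.toHom.map_adj hij
    have h13 := h (f 0) (f 2) (f 1) (f 3) (fun e => absurd (f.injective e) (by decide))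
      (hadj _ _ (by decide)) (hadj _ _ (by decide)) (hadj _ _ (by decide)) (hadj _ _ (by decide))
    exact absurd (f.injective h13) (by decide)

theorem isPartialPolarity_adj {V : Type*} [Fintype V] {G : SimpleGraph V} [DecidableRel G.Adj]
    (h : (cycleGraph 4).Free G) {q r : ℕ} (hV : Fintype.card V + r = q ^ 2 + q + 1) :
    IsPartialPolarity (fun u v => if G.Adj u v then (1 : ℝ) else 0) q r where
  symm u v := by simp [G.adj_comm]
  idem u v := by simp
  codeg u v huv := by
    rw [cycleGraph_four_free_iff] at h
    have hc : ∑ w, (if G.Adj u w then (1 : ℝ) else 0) * (if G.Adj v w then (1 : ℝ) else 0)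
        = #{w | G.Adj u w ∧ G.Adj v w} := by
      rw [← sum_boole]
      exact sum_congr rfl fun w _ => by split_ifs <;> simp_all
    rw [hc, ← Nat.cast_one, Nat.cast_le]
    refine card_le_one.2 fun w hw w' hw' => ?_
    simp only [mem_filter, mem_univ, true_and] at hw hw'
    exact h u v w w' huv hw.1 hw.2 hw'.1 hw'.2
  card := by
    rw [eq_sub_iff_add_eq]
    exact_mod_cast hV
  integral v := ⟨q + 1 - #{w | G.Adj v w}, by simp⟩

theorem two_mul_card_edgeFinset_eq {V : Type*} [Fintype V] (G : SimpleGraph V)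
    [DecidableRel G.Adj] (q : ℝ) :
    2 * (#G.edgeFinset : ℝ) = (q + 1) * Fintype.card V
      - ∑ v, rowDeficit (fun u v => if G.Adj u v then (1 : ℝ) else 0) q v := by
  have h : (∑ v, (G.degree v : ℝ)) = 2 * (#G.edgeFinset : ℝ) := by
    exact_mod_cast G.sum_degrees_eq_twice_card_edges
  rw [← h]
  simp only [rowDeficit, sum_sub_distrib, sum_boole, sum_const, card_univ, nsmul_eq_mul,
    ← card_neighborFinset_eq_degree, neighborFinset_eq_filter]
  ring

theorem exists_extremalNumber_cycleGraph_four_le {ε : ℝ} (hε : 0 < ε) :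
    ∃ δ : ℝ, 0 < δ ∧ δ ≤ 1 ∧ ∃ R : ℕ, ∀ q r n : ℕ, 1 ≤ q → R ≤ r → (r : ℝ) ≤ δ * q →
      n + r = q ^ 2 + q + 1 →
      (extremalNumber n (cycleGraph 4) : ℝ)
        ≤ 1 / 2 * q * ((q : ℝ) + 1) ^ 2 - (1 - ε) * r * q := by
  -- The errors 61κrq and 1300r² are each to be at most εrq/2, whence 122 here and 2600 in δ; κ⁴/7
  -- makes 6r < κ⁴q strict.
  set κ := min 1 (ε / 122) with hκdef
  have hκ : 0 < κ := by positivity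
  have hκ1 : κ ≤ 1 := min_le_left _ _
  have hκε : κ ≤ ε / 122 := min_le_right _ _
  -- As (q + 1)(q² + q + 1) = q(q + 1)² + (q + 1), an excess q + 1 ≤ 2q remains; r ≥ 2/ε absorbs it
  -- into εrq.
  obtain ⟨R, hR⟩ := exists_nat_ge (2 / ε)
  refine ⟨min (1 / 100) (min (κ ^ 4 / 7) (ε / 2600)), by positivity,
    (min_le_left _ _).trans (by norm_num), R, fun q r n hq hRr hrδ hn => ?_⟩
  have hq' : (1 : ℝ) ≤ q := by exact_mod_cast hq
  have hq0 : (0 : ℝ) < q := by linarith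
  have hr0 : (0 : ℝ) ≤ r := by positivity
  have h1 : (r : ℝ) ≤ 1 / 100 * q := hrδ.trans (by gcongr; exact min_le_left _ _)
  have h2 : (r : ℝ) ≤ κ ^ 4 / 7 * q :=
    hrδ.trans (by gcongr; exact (min_le_right _ _).trans (min_le_left _ _))
  have h3 : (r : ℝ) ≤ ε / 2600 * q :=
    hrδ.trans (by gcongr; exact (min_le_right _ _).trans (min_le_right _ _))
  have h4 : 2 ≤ ε * r := by
    have : 2 / ε ≤ r := hR.trans (by exact_mod_cast hRr)
    rw [div_le_iff₀ hε] at this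
    linarith
  have hqr : (r : ℝ) ≤ q := by linarith
  have hnn : (0 : ℝ) ≤ 1 / 2 * q * ((q : ℝ) + 1) ^ 2 - (1 - ε) * r * q := by
    have h5 : (r : ℝ) * q ≤ q * q := by gcongr
    have h6 : 0 ≤ ε * r * q := by positivity
    have h7 : (0 : ℝ) ≤ (q : ℝ) ^ 3 := by positivity
    linarith
  rw [← Fintype.card_fin n, extremalNumber_le_iff_of_nonneg _ hnn]
  intro G _ hG
  have hP := isPartialPolarity_adj hG (q := q) (r := r) (by simpa using hn)
  have hD := hP.sum_rowDeficit_ge hq' hr0 (by linarith) hκ hκ1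
    (by have : 0 < κ ^ 4 * q := by positivity
        linarith)
  have hE := two_mul_card_edgeFinset_eq G q
  rw [hP.card] at hE
  have h5 : 1300 * (r : ℝ) ^ 2 ≤ ε / 2 * (r * q) := by
    have := mul_le_mul_of_nonneg_left h3 (show 0 ≤ 1300 * (r : ℝ) by positivity)
    linarith
  have h6 : 61 * κ * r * q ≤ ε / 2 * (r * q) := by
    have := mul_le_mul_of_nonneg_right hκε (show 0 ≤ 61 * ((r : ℝ) * q) by positivity)
    linarith
  have h7 : 2 * (q : ℝ) ≤ ε * r * q := by gcongr
  linarith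

/-- Deleting a set of vertices loses at most the sum of their degrees. -/
theorem card_edgeFinset_le_induce_compl_add {V : Type*} [Fintype V] [DecidableEq V]
    (G : SimpleGraph V) [DecidableRel G.Adj] (S : Finset V) :
    #G.edgeFinset ≤ #(G.induce {v | v ∉ S}).edgeFinset + ∑ v ∈ S, G.degree v := by
  classical
  have hsub : G.edgeFinset ⊆ (G.induce {v | v ∉ S}).edgeFinset.image (Sym2.map Subtype.val) ∪
      S.biUnion fun v => G.incidenceFinset v := by
    intro e he
    induction e with | _ u v => ?_
    rw [mem_edgeFinset, mem_edgeSet] at he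
    rw [mem_union, mem_biUnion, mem_image]
    by_cases hu : u ∈ S
    · exact Or.inr ⟨u, hu, by simp [mem_incidenceFinset, he]⟩
    by_cases hv : v ∈ S
    · exact Or.inr ⟨v, hv, by simp [mem_incidenceFinset, mk'_mem_incidenceSet_iff, he]⟩
    exact Or.inl ⟨s(⟨u, hu⟩, ⟨v, hv⟩), by simpa using he, by simp⟩
  calc #G.edgeFinset ≤ _ := card_le_card hsub
    _ ≤ _ := card_union_le _ _
    _ ≤ _ := by
      gcongr
      · exact card_image_le
      · refine card_biUnion_le.trans (le_of_eq ?_)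
        exact sum_congr rfl fun v _ => G.card_incidenceFinset_eq_degree v

/-! ### The polarity graph of the projective plane over a field. -/

section PolarityGraph

variable (F : Type*) [Field F]

/-- The incidence relation of the polarity of the projective plane over `F` that sends the affine
point `(a, b)` to the line `y = a * x - b`, the point `m` at infinity to the line `x = m`, and the
point `∞` of vertical directions to the line at infinity. -/
def polarityRel : (F × F) ⊕ Option F → (F × F) ⊕ Option F → Prop
  | .inl p, .inl p' => p.2 + p'.2 = p.1 * p'.1
  | .inl p, .inr (some m) => p.1 = m
  | .inr (some m), .inl p => p.1 = m
  | .inl _, .inr none => False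
  | .inr none, .inl _ => False
  | .inr (some _), .inr (some _) => False
  | .inr _, .inr _ => True

variable {F}

theorem polarityRel_symm {v w : (F × F) ⊕ Option F} (h : polarityRel F v w) :
    polarityRel F w v := by
  rcases v with ⟨a, b⟩ | _ | m <;> rcases w with ⟨c, d⟩ | _ | m' <;> simp_all [polarityRel]
  linear_combination h

theorem polarityRel_unique {u v w w' : (F × F) ⊕ Option F} (huv : u ≠ v)
    (h1 : polarityRel F u w) (h2 : polarityRel F v w) (h3 : polarityRel F u w')
    (h4 : polarityRel F v w') : w = w' := by
  rcases u with ⟨a, b⟩ | _ | m <;> rcases v with ⟨c, d⟩ | _ | m' <;>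
    rcases w with ⟨e, f⟩ | _ | k <;> rcases w' with ⟨e', f'⟩ | _ | k' <;>
    simp only [polarityRel] at h1 h2 h3 h4 <;> try grind
  -- For four affine points, the alternating sum of the incidence equations eliminates the second
  -- coordinates and factors.
  have key : (a - c) * (e - e') = 0 := by linear_combination h2 - h1 + h3 - h4
  rcases mul_eq_zero.1 key with h | h
  · obtain rfl : a = c := sub_eq_zero.1 h
    exact absurd (by rw [add_right_cancel (h1.trans h2.symm)]) huv
  · obtain rfl : e = e' := sub_eq_zero.1 h
    rw [add_left_cancel (h1.trans h3.symm)]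

/-- An enumeration of the points on the polar line of a point. -/
def polarPoint : (F × F) ⊕ Option F → Option F → (F × F) ⊕ Option F
  | .inl p, some c => .inl (c, p.1 * c - p.2)
  | .inl p, none => .inr (some p.1)
  | .inr (some m), some d => .inl (m, d)
  | .inr (some _), none => .inr none
  | .inr none, t => .inr t

theorem polarPoint_injective (v : (F × F) ⊕ Option F) : Function.Injective (polarPoint v) := by
  intro s t h
  rcases v with ⟨a, b⟩ | _ | m <;> rcases s with _ | s <;> rcases t with _ | t <;>
    simp_all [polarPoint]

theorem polarityRel_iff {v w : (F × F) ⊕ Option F} :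
    polarityRel F v w ↔ ∃ t, polarPoint v t = w := by
  rcases v with ⟨a, b⟩ | _ | m <;> rcases w with ⟨c, d⟩ | _ | m' <;>
    simp [polarPoint, polarityRel, Option.exists, eq_comm, eq_sub_iff_add_eq']

/-- An affine point (a, b) is absolute iff 2b = a². In characteristic 2 this forces a = 0 and leaves
b free; otherwise a determines b. The point ∞ is always absolute, and no other point at infinity is.
-/
theorem exists_absolute_enumeration : ∃ g : Option F → (F × F) ⊕ Option F,
    Function.Injective g ∧ ∀ v, polarityRel F v v ↔ ∃ t, g t = v := by
  by_cases h2 : (2 : F) = 0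
  · refine ⟨fun t => t.elim (.inr none) fun b => .inl (0, b), ?_, ?_⟩
    · rintro (_ | s) (_ | t) h <;> simp_all
    · rintro (⟨a, b⟩ | _ | m) <;> simp [polarityRel, Option.exists, ← two_mul, h2, eq_comm]
  · refine ⟨fun t => t.elim (.inr none) fun a => .inl (a, a * a / 2), ?_, ?_⟩
    · rintro (_ | s) (_ | t) h <;> simp_all
    · rintro (⟨a, b⟩ | _ | m) <;>
        simp [polarityRel, Option.exists, ← mul_two, div_eq_iff h2]
      exact eq_comm

variable (F) in
/-- The graph of the polarity `polarityRel`. -/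
def polarityGraph : SimpleGraph ((F × F) ⊕ Option F) where
  Adj v w := v ≠ w ∧ polarityRel F v w
  symm := ⟨fun _ _ h => ⟨h.1.symm, polarityRel_symm h.2⟩⟩
  loopless := ⟨fun _ h => h.1 rfl⟩

theorem cycleGraph_four_free_polarityGraph : (cycleGraph 4).Free (polarityGraph F) :=
  cycleGraph_four_free_iff.2 fun _ _ _ _ huv h1 h2 h3 h4 =>
    polarityRel_unique huv h1.2 h2.2 h3.2 h4.2

open Classical in
theorem degree_polarityGraph [Fintype F] (v : (F × F) ⊕ Option F) :
    (polarityGraph F).degree v + (if polarityRel F v v then 1 else 0) = Fintype.card F + 1 := by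
  have h1 : #({w | polarityRel F v w} : Finset _) = Fintype.card F + 1 := by
    have : ({w | polarityRel F v w} : Finset _) = univ.image (polarPoint v) := by
      ext w; simp [polarityRel_iff]
    rw [this, card_image_of_injective _ (polarPoint_injective v), card_univ, Fintype.card_option]
  rw [← h1, ← card_neighborFinset_eq_degree]
  have h2 : (polarityGraph F).neighborFinset v = ({w | polarityRel F v w} : Finset _).erase v := by
    ext w
    rw [mem_neighborFinset]
    simp [polarityGraph, eq_comm]
  rw [h2]
  split_ifs with h
  · exact card_erase_add_one (by simpa using h)
  · rw [erase_eq_of_notMem (by simpa using h), add_zero]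

open Classical in
theorem card_absolute [Fintype F] :
    #({v | polarityRel F v v} : Finset ((F × F) ⊕ Option F)) = Fintype.card F + 1 := by
  obtain ⟨g, hg, h⟩ := exists_absolute_enumeration (F := F)
  have : ({v | polarityRel F v v} : Finset _) = univ.image g := by
    ext w; simp [h]
  rw [this, card_image_of_injective _ hg, card_univ, Fintype.card_option]

open Classical in
theorem two_mul_card_edgeFinset_polarityGraph [Fintype F] :
    2 * #(polarityGraph F).edgeFinset = Fintype.card F * (Fintype.card F + 1) ^ 2 := by
  have h := sum_congr rfl fun v (_ : v ∈ (univ : Finset ((F × F) ⊕ Option F))) =>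
    degree_polarityGraph v
  rw [sum_add_distrib, sum_degrees_eq_twice_card_edges, sum_boole, card_absolute] at h
  simp only [sum_const, card_univ, Fintype.card_sum, Fintype.card_prod, Fintype.card_option,
    smul_eq_mul, Nat.cast_id] at h
  nlinarith

end PolarityGraph

/-- Deleting absolute points is cheapest: the loop lost at each of them leaves degree q instead of q
+ 1. -/
theorem le_extremalNumber_cycleGraph_four {q r n : ℕ} (hq : IsPrimePow q) (hrq : r ≤ q)
    (hn : n + r = q ^ 2 + q + 1) :
    1 / 2 * (q : ℝ) * ((q : ℝ) + 1) ^ 2 - r * q ≤ extremalNumber n (cycleGraph 4) := by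
  classical
  obtain ⟨F, _, _, hF⟩ : ∃ (F : Type) (_ : Field F) (_ : Fintype F), Fintype.card F = q := by
    obtain ⟨hfield⟩ := (Fintype.nonempty_field_iff (α := Fin q)).2 (by simpa using hq)
    exact ⟨Fin q, hfield, inferInstance, Fintype.card_fin q⟩
  obtain ⟨S, hS, hSr⟩ := exists_subset_card_eq
    (show r ≤ #({v | polarityRel F v v} : Finset ((F × F) ⊕ Option F)) by
      rw [card_absolute, hF]; omega)
  have hdeg : ∑ v ∈ S, (polarityGraph F).degree v = r * q := by
    rw [← hSr, ← smul_eq_mul, ← sum_const]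
    refine sum_congr rfl fun v hv => ?_
    have hv' : polarityRel F v v := by simpa using hS hv
    have := degree_polarityGraph v
    rw [if_pos hv', hF] at this
    omega
  have hle := card_edgeFinset_le_induce_compl_add (polarityGraph F) S
  have hfree : (cycleGraph 4).Free ((polarityGraph F).induce {v | v ∉ S}) := fun h =>
    cycleGraph_four_free_polarityGraph (h.trans ⟨Copy.induce _ _⟩)
  have hex := card_edgeFinset_le_extremalNumber hfree
  have hn' : Fintype.card {v : (F × F) ⊕ Option F | v ∉ S} = n := by
    have h1 : Fintype.card {v : (F × F) ⊕ Option F // v ∉ S} = _ :=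
      Fintype.card_subtype_compl (· ∈ S)
    rw [Fintype.card_coe, hSr, Fintype.card_sum, Fintype.card_prod, Fintype.card_option, hF,
      ← sq, ← add_assoc, ← hn, Nat.add_sub_cancel] at h1
    exact h1
  rw [hn'] at hex
  have h2 := two_mul_card_edgeFinset_polarityGraph (F := F)
  rw [hF] at h2
  rw [hdeg] at hle
  have h3 : q * (q + 1) ^ 2 ≤ 2 * extremalNumber n (cycleGraph 4) + 2 * (r * q) := by
    rw [← h2]
    linarith
  have h4 : (q : ℝ) * ((q : ℝ) + 1) ^ 2 ≤ 2 * extremalNumber n (cycleGraph 4) + 2 * (r * q) := by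
    exact_mod_cast h3
  linarith

end SimpleGraph

theorem mainTheorem3 (ε : ℝ) (hε : 0 < ε) :
    ∃ δ : ℝ, 0 < δ ∧ ∃ R : ℕ, ∀ q r n : ℕ, IsPrimePow q → R ≤ r → (r : ℝ) ≤ δ * (q : ℝ) →
      n + r = q ^ 2 + q + 1 →
      (1 / 2 : ℝ) * (q : ℝ) * ((q : ℝ) + 1) ^ 2 - (r : ℝ) * (q : ℝ)
          ≤ (SimpleGraph.extremalNumber n (SimpleGraph.cycleGraph 4) : ℝ) ∧
        (SimpleGraph.extremalNumber n (SimpleGraph.cycleGraph 4) : ℝ)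
          ≤ (1 / 2 : ℝ) * (q : ℝ) * ((q : ℝ) + 1) ^ 2 - (1 - ε) * (r : ℝ) * (q : ℝ) := by
  obtain ⟨δ, hδ, hδ1, R, h⟩ := SimpleGraph.exists_extremalNumber_cycleGraph_four_le hε
  refine ⟨δ, hδ, R, fun q r n hq hR hr hn =>
    ⟨SimpleGraph.le_extremalNumber_cycleGraph_four hq ?_ hn, h q r n hq.one_lt.le hR hr hn⟩⟩
  have : (r : ℝ) ≤ q := hr.trans (mul_le_of_le_one_left (by positivity) hδ1)
  exact_mod_cast this
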